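/- Let $(\zeta_k)_{k\ge 0}$ be i.i.d. standard complex Gaussian random variables on a probability space, i.e. $\zeta_k\sim N_{\mathbb C}(0,1)$ has independent real and imaginary parts, each real Gaussian with mean $0$ and variance $1/2$. Let \[ f_0(z)=\sum_{k=0}^\infty \zeta_k\frac{z^k}{\sqrt{k!}},\qquad f_n(z,\bar z)=\frac1{\sqrt{n!}}\,(\partial_z-\bar z)^n f_0(z)\quad(n\ge 0,\ z\in\mathbb C), \] where $\partial_z=\frac12(\partial_x-i\partial_y)$; almost surely, the series defining $f_0(z)$ converges absolutely for every $z\in\mathbb C$. For $N\ge1$ put \[ S_N(z)=\frac1N\sum_{n=0}^{N-1}\bigl|e^{-|z|^2/2}f_n(z,\bar z)\bigr|^2,\qquad z\in\mathbb C. \] For a compact set $K\subset\mathbb C$ and $0<\alpha<1$, let $C^{0,\alpha}(K)$ be the space of continuous functions $u$ on $K$ with \[ [u]_{C^{0,\alpha}(K)}=\sup_{z,w\in K,\ z\ne w}\frac{|u(z)-u(w)|}{|z-w|^\alpha}<\infty, \] with norm $\|u\|_{C^{0,\alpha}(K)}=\sup_{K}|u|+[u]_{C^{0,\alpha}(K)}$.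 Then, for every compact $K\subset\mathbb C$ and every $0<\alpha<1$, almost surely $S_N\to1$ in $C^{0,\alpha}(K)$ as $N\to\infty$; that is, almost surely $S_N|_K\in C^{0,\alpha}(K)$ for all $N$ and $\|S_N-1\|_{C^{0,\alpha}(K)}\to0$. -/

import Mathlib

open MeasureTheory ProbabilityTheory Filter Topology
open scoped ENNReal

noncomputable section

namespace LandauLevels

/-- The standard complex Gaussian law `N_ℂ(0,1)`: independent real and imaginary parts,
each centered Gaussian with variance `1/2`. -/
def stdComplexGaussian : Measure ℂ :=
  ((gaussianReal 0 (1 / 2)).prod (gaussianReal 0 (1 / 2))).map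
    (fun p : ℝ × ℝ => (⟨p.1, p.2⟩ : ℂ))

/-- The `k`-th term `c_k z^k / √(k!)` of the Gaussian entire function with coefficients `c`. -/
def gefTerm (c : ℕ → ℂ) (z : ℂ) (k : ℕ) : ℂ :=
  c k * (z ^ k / (Real.sqrt (k.factorial : ℝ) : ℂ))

/-- `f₀(z) = ∑ₖ c_k z^k / √(k!)`. -/
def gef (c : ℕ → ℂ) (z : ℂ) : ℂ :=
  ∑' k : ℕ, gefTerm c z k

/-- The Wirtinger derivative `∂_z g = (∂_x g - i ∂_y g) / 2`. -/
def dz (g : ℂ → ℂ) (z : ℂ) : ℂ :=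
  (1 / 2 : ℂ) * (fderiv ℝ g z 1 - Complex.I * fderiv ℝ g z Complex.I)

/-- The Landau level raising operator `∂_z - z̄`. -/
def raising (g : ℂ → ℂ) (z : ℂ) : ℂ :=
  dz g z - (starRingEnd ℂ) z * g z

/-- `f_n = (n!)^{-1/2} (∂_z - z̄)^n f₀`. -/
def landauField (c : ℕ → ℂ) (n : ℕ) (z : ℂ) : ℂ :=
  (1 / (Real.sqrt (n.factorial : ℝ) : ℂ)) * (raising^[n] (gef c)) z

/-- `S_N(z) = (1/N) ∑_{n<N} |e^{-|z|²/2} f_n(z)|²`. -/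
def averagedField (c : ℕ → ℂ) (N : ℕ) (z : ℂ) : ℝ :=
  (1 / (N : ℝ)) * ∑ n ∈ Finset.range N,
    ‖(Real.exp (-‖z‖ ^ 2 / 2) : ℂ) * landauField c n z‖ ^ 2

/-- The Hölder seminorm `[u]_{C^{0,α}(K)}`, possibly infinite. -/
def holderSeminorm (α : ℝ) (K : Set ℂ) (u : ℂ → ℝ) : ℝ≥0∞ :=
  ⨆ (z ∈ K) (w ∈ K) (_ : z ≠ w), ENNReal.ofReal (|u z - u w| / ‖z - w‖ ^ α)

/-- The Hölder norm `sup_K |u| + [u]_{C^{0,α}(K)}`, possibly infinite. -/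
def holderNorm (α : ℝ) (K : Set ℂ) (u : ℂ → ℝ) : ℝ≥0∞ :=
  (⨆ z ∈ K, ENNReal.ofReal |u z|) + holderSeminorm α K u

/-- The restriction of `u` to `K` belongs to `C^{0,α}(K)`. -/
def MemHolderSpace (α : ℝ) (K : Set ℂ) (u : ℂ → ℝ) : Prop :=
  ContinuousOn u K ∧ holderSeminorm α K u < ∞

/-- Convergence `u_N → v` in the normed space `C^{0,α}(K)`: all functions belong to the space
and the norm of the difference tends to zero. -/
def TendstoHolder (α : ℝ) (K : Set ℂ) (u : ℕ → ℂ → ℝ) (v : ℂ → ℝ) : Prop :=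
  (∀ N, MemHolderSpace α K (u N)) ∧ MemHolderSpace α K v ∧
    Tendsto (fun N => holderNorm α K (fun z => u N z - v z)) atTop (𝓝 0)

end LandauLevels

end

/-!
The Wirtinger derivatives of the weighted fields `φ_n = e^{-|z|²/2} f_n` move them to the
neighbouring levels, so `∇|φ_n|²` is an increment in `n` of a multiple of `√n φ̄_n φ_{n-1}`. The sum
telescopes, and the gradient of `S_N` is `2 φ̄_N φ_{N-1} / √N`. For fixed `z`, the variable `φ_n(z)`
is a Gaussian series whose coefficients form a unit vector, so its tails do not depend on `n` or
`z`. A polynomially fine net together with the Borel–Cantelli lemma therefore gives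
`|φ_n|² = O(log n)` locally uniformly, and the Lipschitz constant of `S_N` on a ball is
`O(log N / √N)`. As `φ_n(0) = ζ_n`, the strong law of large numbers gives `S_N(0) → 1`.
-/

noncomputable section

namespace LandauLevels

open Metric
open scoped ComplexConjugate NNReal

/-! ### Wirtinger calculus and gradients -/

/-- The real-linear map `v ↦ a v + b v̄`: the real differential of a function whose Wirtinger
derivatives `∂_z` and `∂_z̄` are `a` and `b`. -/
def wirtingerCLM (a b : ℂ) : ℂ →L[ℝ] ℂ :=
  ContinuousLinearMap.mul ℝ ℂ a +
    (ContinuousLinearMap.mul ℝ ℂ b).comp (Complex.conjCLE : ℂ →L[ℝ] ℂ)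

@[simp] lemma wirtingerCLM_apply (a b v : ℂ) : wirtingerCLM a b v = a * v + b * conj v := by
  simp [wirtingerCLM]

lemma smul_wirtingerCLM (c a b : ℂ) : c • wirtingerCLM a b = wirtingerCLM (c * a) (c * b) :=
  ContinuousLinearMap.ext fun v => by simp [mul_add, mul_assoc]

lemma norm_wirtingerCLM_le (a b : ℂ) : ‖wirtingerCLM a b‖ ≤ ‖a‖ + ‖b‖ :=
  ContinuousLinearMap.opNorm_le_bound _ (by positivity) fun v =>
    (norm_add_le _ _).trans_eq (by simp [add_mul])

lemma hasSum_wirtingerCLM {ι : Type*} {a b : ι → ℂ} {A B : ℂ} (ha : HasSum a A)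
    (hb : HasSum b B) : HasSum (fun i => wirtingerCLM (a i) (b i)) (wirtingerCLM A B) :=
  (ha.mapL (ContinuousLinearMap.mul ℝ ℂ)).add
    (hb.mapL ((ContinuousLinearMap.compL ℝ ℂ ℂ ℂ).flip (Complex.conjCLE : ℂ →L[ℝ] ℂ) ∘L
      ContinuousLinearMap.mul ℝ ℂ))

lemma hasFDerivAt_conj (z : ℂ) : HasFDerivAt (fun w : ℂ => conj w) (wirtingerCLM 0 1) z :=
  (Complex.conjCLE : ℂ →L[ℝ] ℂ).hasFDerivAt.congr_fderiv (by ext; simp)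

lemma dz_eq_of_hasFDerivAt {g : ℂ → ℂ} {a b z : ℂ} (hg : HasFDerivAt g (wirtingerCLM a b) z) :
    dz g z = a := by
  rw [dz, hg.fderiv]
  simp only [wirtingerCLM_apply, map_one, Complex.conj_I]
  linear_combination (-(1 / 2 : ℂ) * (a - b)) * Complex.I_mul_I

lemma hasFDerivAt_tsum_of_wirtinger_bound {ι : Type*} {f a b : ι → ℂ → ℂ} {u v w : ι → ℝ}
    {s : Set ℂ} (hs : IsOpen s) (hs' : IsPreconnected s) (hu : Summable u) (hv : Summable v)
    (hw : Summable w) (hf : ∀ i, ∀ z ∈ s, ‖f i z‖ ≤ u i) (ha : ∀ i, ∀ z ∈ s, ‖a i z‖ ≤ v i)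
    (hb : ∀ i, ∀ z ∈ s, ‖b i z‖ ≤ w i)
    (hderiv : ∀ i, ∀ z ∈ s, HasFDerivAt (f i) (wirtingerCLM (a i z) (b i z)) z)
    {z : ℂ} (hz : z ∈ s) :
    HasFDerivAt (fun z => ∑' i, f i z) (wirtingerCLM (∑' i, a i z) (∑' i, b i z)) z := by
  have hsum {g : ι → ℂ → ℂ} {t : ι → ℝ} (ht : Summable t) (hg : ∀ i, ∀ z ∈ s, ‖g i z‖ ≤ t i) :
      Summable fun i => g i z :=
    ht.of_norm_bounded fun i => hg i z hz
  rw [← (hasSum_wirtingerCLM (hsum hv ha).hasSum (hsum hw hb).hasSum).tsum_eq]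
  exact hasFDerivAt_tsum_of_isPreconnected (hv.add hw) hs hs' hderiv
    (fun i z hz => (norm_wirtingerCLM_le _ _).trans (add_le_add (ha i z hz) (hb i z hz)))
    hz (hsum hu hf) hz

lemma hasGradientAt_exp_mul_norm_sq {g : ℂ → ℂ} {a b z : ℂ}
    (hg : HasFDerivAt g (wirtingerCLM a b) z) :
    HasGradientAt (fun z => Real.exp (-‖z‖ ^ 2) * ‖g z‖ ^ 2)
      (2 * Real.exp (-‖z‖ ^ 2) * (conj a * g z + conj (g z) * b - z * ‖g z‖ ^ 2)) z := by
  have hderiv := (((hasFDerivAt_id (𝕜 := ℝ) z).norm_sq.neg).exp).mul hg.norm_sq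
  simp only [id, Pi.neg_apply] at hderiv
  rw [hasGradientAt_iff_hasFDerivAt]
  refine hderiv.congr_fderiv (ContinuousLinearMap.ext fun v => ?_)
  have hnorm : ‖g z‖ ^ 2 = (g z).re * (g z).re + (g z).im * (g z).im := by
    rw [← Complex.normSq_eq_norm_sq, Complex.normSq_apply]
  rw [← Complex.ofReal_pow, hnorm]
  generalize Real.exp (-‖z‖ ^ 2) = e
  simp [real_inner_eq_re_inner, RCLike.inner_apply]
  ring

section Gradient

variable {F : Type*} [NormedAddCommGroup F] [InnerProductSpace ℝ F] [CompleteSpace F] {x : F}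

lemma hasGradientAt_fun_sum {ι : Type*} {s : Finset ι} {f : ι → F → ℝ} {f' : ι → F}
    (hf : ∀ i ∈ s, HasGradientAt (f i) (f' i) x) :
    HasGradientAt (fun y => ∑ i ∈ s, f i y) (∑ i ∈ s, f' i) x := by
  simp only [hasGradientAt_iff_hasFDerivAt, map_sum] at hf ⊢
  exact HasFDerivAt.fun_sum hf

lemma hasGradientAt_const_mul {f : F → ℝ} {f' : F} (r : ℝ) (hf : HasGradientAt f f' x) :
    HasGradientAt (fun y => r * f y) (r • f') x := by
  rw [hasGradientAt_iff_hasFDerivAt, map_smul]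
  exact hf.hasFDerivAt.const_mul r

lemma abs_sub_le_of_hasGradientAt_of_norm_le {s : Set F} (hs : Convex ℝ s) {f : F → ℝ}
    {f' : F → F} {C : ℝ} (hf : ∀ x ∈ s, HasGradientAt f (f' x) x) (hC : ∀ x ∈ s, ‖f' x‖ ≤ C)
    {x y : F} (hx : x ∈ s) (hy : y ∈ s) : |f x - f y| ≤ C * ‖x - y‖ :=
  hs.norm_image_sub_le_of_norm_hasFDerivWithin_le
    (fun z hz => (hf z hz).hasFDerivAt.hasFDerivWithinAt)
    (fun z hz => ((InnerProductSpace.toDual ℝ F).norm_map _).trans_le (hC z hz)) hy hx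

end Gradient

/-! ### Modes of the Landau levels -/

lemma ofReal_sqrt_natCast_mul_self (k : ℕ) : (√k : ℂ) * (√k : ℂ) = k := by
  rw [← Complex.ofReal_mul, Real.mul_self_sqrt k.cast_nonneg, Complex.ofReal_natCast]

lemma ofReal_sqrt_succ_ne_zero (k : ℕ) : (√(k + 1 : ℕ) : ℂ) ≠ 0 :=
  Complex.ofReal_ne_zero.2 (Real.sqrt_ne_zero'.2 (by positivity))

lemma sqrt_factorial_succ (k : ℕ) :
    √((k + 1).factorial : ℝ) = √(k + 1 : ℕ) * √(k.factorial : ℝ) := by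
  rw [Nat.factorial_succ, Nat.cast_mul, Real.sqrt_mul (Nat.cast_nonneg _)]

lemma sqrt_factorial_pos (k : ℕ) : 0 < √(k.factorial : ℝ) :=
  Real.sqrt_pos.2 (by exact_mod_cast k.factorial_pos)

lemma ofReal_sqrt_factorial_ne_zero (k : ℕ) : (√(k.factorial : ℝ) : ℂ) ≠ 0 :=
  Complex.ofReal_ne_zero.2 (sqrt_factorial_pos k).ne'

/-- The `k`-th basis function `(∂_z - z̄)^n (z^k / √k!) / √n!` of the `n`-th Landau level, without
the Gaussian weight. In the recursion the truncated `k - 1` at `k = 0` comes with the factor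
`√0 = 0`. -/
def landauMode : ℕ → ℕ → ℂ → ℂ
  | 0, k, z => z ^ k / (√(k.factorial : ℝ) : ℂ)
  | n + 1, k, z => ((√k : ℂ) * landauMode n (k - 1) z - conj z * landauMode n k z) /
      (√(n + 1 : ℕ) : ℂ)

lemma sqrt_succ_mul_landauMode_succ (n k : ℕ) (z : ℂ) :
    (√(n + 1 : ℕ) : ℂ) * landauMode (n + 1) k z =
      (√k : ℂ) * landauMode n (k - 1) z - conj z * landauMode n k z :=
  mul_div_cancel₀ _ (ofReal_sqrt_succ_ne_zero n)

lemma natCast_mul_landauMode (n k : ℕ) (z : ℂ) :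
    (n : ℂ) * landauMode n k z = (√n : ℂ) *
      ((√k : ℂ) * landauMode (n - 1) (k - 1) z - conj z * landauMode (n - 1) k z) := by
  cases n with
  | zero => simp
  | succ n =>
    rw [Nat.add_sub_cancel, ← sqrt_succ_mul_landauMode_succ, ← mul_assoc,
      ofReal_sqrt_natCast_mul_self]

lemma landauMode_zero_succ (k : ℕ) (z : ℂ) :
    (√(k + 1 : ℕ) : ℂ) * landauMode 0 (k + 1) z = z * landauMode 0 k z := by
  simp only [landauMode]
  rw [sqrt_factorial_succ, Complex.ofReal_mul]
  field_simp
  ring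

-- The ladder in `k`, which commutes with the ladder in `n` defining the modes.
lemma sqrt_succ_mul_landauMode (n k : ℕ) (z : ℂ) :
    (√(k + 1 : ℕ) : ℂ) * landauMode n (k + 1) z =
      z * landauMode n k z + (√n : ℂ) * landauMode (n - 1) k z := by
  induction n generalizing k with
  | zero => simpa using landauMode_zero_succ k z
  | succ n ih =>
    have lower : (√k : ℂ) * ((√k : ℂ) * landauMode n k z) =
        (√k : ℂ) * (z * landauMode n (k - 1) z + (√n : ℂ) * landauMode (n - 1) (k - 1) z) := by
      cases k with
      | zero => simp
      | succ k => rw [ih k, Nat.add_sub_cancel]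
    have raise := natCast_mul_landauMode n k z
    have hk := ofReal_sqrt_natCast_mul_self (k + 1)
    have hk' := ofReal_sqrt_natCast_mul_self k
    have hn := ofReal_sqrt_natCast_mul_self (n + 1)
    have hscaled :
        (√(n + 1 : ℕ) : ℂ) * ((√(k + 1 : ℕ) : ℂ) * landauMode (n + 1) (k + 1) z) =
          (√(n + 1 : ℕ) : ℂ) *
            (z * landauMode (n + 1) k z + (√(n + 1 : ℕ) : ℂ) * landauMode n k z) := by
      have hraise := sqrt_succ_mul_landauMode_succ n (k + 1) z
      have hraise' := sqrt_succ_mul_landauMode_succ n k z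
      rw [Nat.add_sub_cancel] at hraise
      push_cast at *
      linear_combination (√(k + 1 : ℝ) : ℂ) * hraise - z * hraise'
        + landauMode n k z * (hk - hn - hk') - conj z * ih k + lower - raise
    simpa using mul_left_cancel₀ (ofReal_sqrt_succ_ne_zero n) hscaled

lemma hasFDerivAt_landauMode_zero (k : ℕ) (z : ℂ) :
    HasFDerivAt (landauMode 0 k) (wirtingerCLM ((√k : ℂ) * landauMode 0 (k - 1) z) 0) z := by
  refine (((hasDerivAt_pow k z).div_const (√(k.factorial : ℝ) : ℂ)).hasFDerivAt.restrictScalars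
    ℝ).congr_fderiv (ContinuousLinearMap.ext fun v => ?_)
  have hk : (k : ℂ) * z ^ (k - 1) / (√(k.factorial : ℝ) : ℂ) =
      (√k : ℂ) * landauMode 0 (k - 1) z := by
    cases k with
    | zero => simp
    | succ k =>
      rw [landauMode, sqrt_factorial_succ, ← ofReal_sqrt_natCast_mul_self, Complex.ofReal_mul,
        Nat.add_sub_cancel]
      field_simp
  simp [← hk, mul_comm]

lemma hasFDerivAt_landauMode (n k : ℕ) (z : ℂ) :
    HasFDerivAt (landauMode n k)
      (wirtingerCLM ((√k : ℂ) * landauMode n (k - 1) z)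
        (-((√n : ℂ) * landauMode (n - 1) k z))) z := by
  induction n generalizing k with
  | zero => simpa using hasFDerivAt_landauMode_zero k z
  | succ n ih =>
    have hderiv := (((ih (k - 1)).const_mul (√k : ℂ)).sub
      ((hasFDerivAt_conj z).mul (ih k))).mul_const (√(n + 1 : ℕ) : ℂ)⁻¹
    simp only [landauMode, div_eq_mul_inv]
    refine hderiv.congr_fderiv (ContinuousLinearMap.ext fun v => ?_)
    have hn := ofReal_sqrt_natCast_mul_self (n + 1)
    have raise := natCast_mul_landauMode n k z
    simp only [sub_apply, add_apply, smul_apply, wirtingerCLM_apply, smul_eq_mul,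
      Nat.add_sub_cancel]
    field_simp
    push_cast at *
    linear_combination (conj v) * raise + conj v * landauMode n k z * hn

lemma landauMode_apply_zero (n k : ℕ) : landauMode n k 0 = if n = k then 1 else 0 := by
  induction n generalizing k with
  | zero => cases k <;> simp [landauMode]
  | succ n ih =>
    rw [landauMode, ih]
    cases k with
    | zero => simp
    | succ k =>
      by_cases h : n = k
      · subst h; simpa using div_self (ofReal_sqrt_succ_ne_zero n)
      · simp [h]

lemma norm_landauMode_succ_le {R : ℝ} {z : ℂ} (hz : ‖z‖ ≤ R) (n k : ℕ) :
    ‖landauMode (n + 1) k z‖ ≤ √k * ‖landauMode n (k - 1) z‖ + R * ‖landauMode n k z‖ := by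
  have hn : 1 ≤ √(n + 1 : ℕ) := Real.one_le_sqrt.2 (by exact_mod_cast n.succ_pos)
  calc ‖landauMode (n + 1) k z‖
      ≤ ‖(√k : ℂ) * landauMode n (k - 1) z - conj z * landauMode n k z‖ := by
        rw [landauMode, norm_div, Complex.norm_of_nonneg (Real.sqrt_nonneg _)]
        exact div_le_self (norm_nonneg _) hn
    _ ≤ √k * ‖landauMode n (k - 1) z‖ + ‖z‖ * ‖landauMode n k z‖ := by
        refine (norm_sub_le _ _).trans_eq ?_
        rw [norm_mul, norm_mul, RCLike.norm_conj, Complex.norm_of_nonneg (Real.sqrt_nonneg _)]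
    _ ≤ _ := by gcongr

lemma sqrt_mul_pow_pred_div_sqrt_factorial_le {x : ℝ} (hx : 1 ≤ x) (k : ℕ) :
    √k * (x ^ (k - 1) / √((k - 1).factorial : ℝ)) ≤ 2 ^ k * (x ^ k / √(k.factorial : ℝ)) := by
  cases k with
  | zero => simp
  | succ k =>
    have hk : ((k + 1 : ℕ) : ℝ) ≤ 2 ^ (k + 1) := by exact_mod_cast Nat.lt_two_pow_self.le
    have hsq : √(k + 1 : ℕ) * √(k + 1 : ℕ) = (k + 1 : ℕ) := Real.mul_self_sqrt (Nat.cast_nonneg _)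
    calc √(k + 1 : ℕ) * (x ^ k / √(k.factorial : ℝ))
        = (k + 1 : ℕ) * (x ^ k / √((k + 1).factorial : ℝ)) := by
          rw [sqrt_factorial_succ]
          field_simp
          linear_combination hsq
      _ ≤ 2 ^ (k + 1) * (x ^ (k + 1) / √((k + 1).factorial : ℝ)) := by
          gcongr
          exact k.le_succ

lemma norm_landauMode_le {R : ℝ} (hR : 1 ≤ R) {z : ℂ} (hz : ‖z‖ ≤ R) (n k : ℕ) :
    ‖landauMode n k z‖ ≤ (2 * R) ^ n * ((2 ^ n * R) ^ k / √(k.factorial : ℝ)) := by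
  induction n generalizing k with
  | zero =>
    rw [landauMode, norm_div, norm_pow, Complex.norm_of_nonneg (Real.sqrt_nonneg _)]
    simp only [pow_zero, one_mul]
    gcongr
  | succ n ih =>
    have hnR : 1 ≤ 2 ^ n * R := one_le_mul_of_one_le_of_one_le (one_le_pow₀ one_le_two) hR
    calc ‖landauMode (n + 1) k z‖
        ≤ √k * ((2 * R) ^ n * ((2 ^ n * R) ^ (k - 1) / √((k - 1).factorial : ℝ))) +
          R * ((2 * R) ^ n * ((2 ^ n * R) ^ k / √(k.factorial : ℝ))) := by
          refine (norm_landauMode_succ_le hz n k).trans ?_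
          gcongr <;> exact ih _
      _ ≤ (2 * R) ^ n * (2 ^ k * ((2 ^ n * R) ^ k / √(k.factorial : ℝ))) +
          R * ((2 * R) ^ n * (2 ^ k * ((2 ^ n * R) ^ k / √(k.factorial : ℝ)))) := by
          rw [mul_left_comm]
          gcongr _ * ?_ + R * (_ * ?_)
          · exact sqrt_mul_pow_pred_div_sqrt_factorial_le hnR k
          · exact le_mul_of_one_le_left (by positivity) (one_le_pow₀ one_le_two)
      _ = (1 + R) * ((2 * R) ^ n * ((2 ^ (n + 1) * R) ^ k / √(k.factorial : ℝ))) := by ring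
      _ ≤ (2 * R) * ((2 * R) ^ n * ((2 ^ (n + 1) * R) ^ k / √(k.factorial : ℝ))) := by
          gcongr
          linarith
      _ = (2 * R) ^ (n + 1) * ((2 ^ (n + 1) * R) ^ k / √(k.factorial : ℝ)) := by ring

lemma summable_pow_div_sqrt_factorial (x : ℝ) :
    Summable fun k : ℕ => x ^ k / √(k.factorial : ℝ) := by
  have hmajorant : Summable fun k : ℕ => (4 * x ^ 2) ^ k / k.factorial + (1 / 4 : ℝ) ^ k :=
    (Real.summable_pow_div_factorial _).add
      (summable_geometric_of_lt_one (by norm_num) (by norm_num))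
  refine hmajorant.of_norm_bounded fun k => ?_
  -- AM-GM for the product of `(2 x)^k / √k!` and `2⁻ᵏ`
  have hsplit : x ^ k / √(k.factorial : ℝ) = ((2 * x) ^ k / √(k.factorial : ℝ)) * (1 / 2) ^ k := by
    rw [div_mul_eq_mul_div, ← mul_pow]
    ring_nf
  have hsq : ((2 * x) ^ k / √(k.factorial : ℝ)) ^ 2 = (4 * x ^ 2) ^ k / k.factorial := by
    rw [div_pow, Real.sq_sqrt (Nat.cast_nonneg _), pow_right_comm, mul_pow]
    norm_num
  have hquarter : ((1 / 2 : ℝ) ^ k) ^ 2 = (1 / 4) ^ k := by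
    rw [pow_right_comm]
    norm_num
  rw [hsplit, ← hsq, ← hquarter, norm_mul, ← sq_abs (_ / _), ← sq_abs (_ ^ k)]
  have := two_mul_le_add_sq ‖(2 * x) ^ k / √(k.factorial : ℝ)‖ ‖(1 / 2 : ℝ) ^ k‖
  exact (le_mul_of_one_le_left (by positivity) one_le_two).trans (by rwa [← mul_assoc])

lemma summable_norm_landauMode (n : ℕ) (z : ℂ) : Summable fun k => ‖landauMode n k z‖ :=
  .of_nonneg_of_le (fun _ => norm_nonneg _)
    (norm_landauMode_le (le_max_left 1 ‖z‖) (le_max_right 1 ‖z‖) n)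
    ((summable_pow_div_sqrt_factorial _).mul_left _)

lemma summable_landauMode_mul_conj (m n : ℕ) (z : ℂ) :
    Summable fun k => landauMode m k z * conj (landauMode n k z) :=
  (summable_norm_landauMode m z).mul_tendsto_const
    ((Complex.continuous_conj.tendsto 0).comp
      (summable_norm_landauMode n z).of_norm.tendsto_cofinite_zero)

lemma landauMode_mul_conj_self (n k : ℕ) (z : ℂ) :
    landauMode n k z * conj (landauMode n k z) = (‖landauMode n k z‖ ^ 2 : ℝ) := by
  rw [Complex.mul_conj, Complex.normSq_eq_norm_sq]

lemma hasSum_norm_landauMode_zero_sq (z : ℂ) :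
    HasSum (fun k => ‖landauMode 0 k z‖ ^ 2) (Real.exp (‖z‖ ^ 2)) := by
  have hterm (k : ℕ) : ‖landauMode 0 k z‖ ^ 2 = (‖z‖ ^ 2) ^ k / k.factorial := by
    rw [landauMode, norm_div, norm_pow, Complex.norm_of_nonneg (Real.sqrt_nonneg _), div_pow,
      Real.sq_sqrt (Nat.cast_nonneg _), pow_right_comm]
  simp only [hterm, Real.exp_eq_exp_ℝ]
  exact NormedSpace.expSeries_div_hasSum_exp _

lemma hasSum_sqrt_mul_landauMode_pred_mul_conj {n : ℕ} {z E : ℂ}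
    (hE : HasSum (fun k => landauMode n k z * conj (landauMode n k z)) E) :
    HasSum (fun k : ℕ => (√k : ℂ) * landauMode n (k - 1) z * conj (landauMode (n + 1) k z))
      (conj z * ∑' k, landauMode n k z * conj (landauMode (n + 1) k z) +
        (√(n + 1 : ℕ) : ℂ) * E) := by
  rw [← hasSum_nat_add_iff' 1]
  simp only [Finset.range_one, Finset.sum_singleton, Nat.cast_zero, Real.sqrt_zero,
    Complex.ofReal_zero, zero_mul, sub_zero]
  refine (((summable_landauMode_mul_conj n (n + 1) z).hasSum.mul_left _).add
    (hE.mul_left _)).congr_fun fun k => ?_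
  have lower := congrArg conj (sqrt_succ_mul_landauMode (n + 1) k z)
  simp only [map_mul, map_add, Complex.conj_ofReal, Nat.add_sub_cancel] at lower ⊢
  linear_combination landauMode n k z * lower

-- Expand one factor of the norm of row `n + 1` by the ladder in `n`. Its first term, after the
-- ladder in `k`, is the norm of row `n` plus a multiple of the inner product of the two rows, and
-- that multiple cancels against the second term.
lemma hasSum_landauMode_mul_conj_self (n : ℕ) (z : ℂ) :
    HasSum (fun k => landauMode n k z * conj (landauMode n k z)) (Real.exp (‖z‖ ^ 2) : ℂ) := by
  induction n with
  | zero =>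
    simp only [landauMode_mul_conj_self]
    exact Complex.hasSum_ofReal.2 (hasSum_norm_landauMode_zero_sq z)
  | succ n ih =>
    have hraise := (hasSum_sqrt_mul_landauMode_pred_mul_conj ih).sub
      ((summable_landauMode_mul_conj n (n + 1) z).hasSum.mul_left (conj z))
    rw [← hasSum_mul_left_iff (ofReal_sqrt_succ_ne_zero n)]
    rw [add_sub_cancel_left] at hraise
    refine hraise.congr_fun fun k => ?_
    linear_combination conj (landauMode (n + 1) k z) * sqrt_succ_mul_landauMode_succ n k z

lemma hasSum_norm_landauMode_sq (n : ℕ) (z : ℂ) :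
    HasSum (fun k => ‖landauMode n k z‖ ^ 2) (Real.exp (‖z‖ ^ 2)) := by
  rw [← Complex.hasSum_ofReal]
  simpa only [landauMode_mul_conj_self] using hasSum_landauMode_mul_conj_self n z

lemma succ_mul_norm_landauMode_sq_le (n k : ℕ) (z : ℂ) :
    ((k : ℝ) + 1) * ‖landauMode n (k + 1) z‖ ^ 2 ≤
      2 * (‖z‖ ^ 2 * ‖landauMode n k z‖ ^ 2 + n * ‖landauMode (n - 1) k z‖ ^ 2) := by
  have hlower : √(k + 1 : ℕ) * ‖landauMode n (k + 1) z‖ ≤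
      ‖z‖ * ‖landauMode n k z‖ + √n * ‖landauMode (n - 1) k z‖ := by
    have := norm_add_le (z * landauMode n k z) (√n * landauMode (n - 1) k z)
    rwa [← sqrt_succ_mul_landauMode, norm_mul, norm_mul, norm_mul,
      Complex.norm_of_nonneg (Real.sqrt_nonneg _), Complex.norm_of_nonneg (Real.sqrt_nonneg _)]
      at this
  calc ((k : ℝ) + 1) * ‖landauMode n (k + 1) z‖ ^ 2
      = (√(k + 1 : ℕ) * ‖landauMode n (k + 1) z‖) ^ 2 := by
        rw [mul_pow, Real.sq_sqrt (Nat.cast_nonneg _), Nat.cast_succ]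
    _ ≤ (‖z‖ * ‖landauMode n k z‖ + √n * ‖landauMode (n - 1) k z‖) ^ 2 := by gcongr
    _ ≤ 2 * ((‖z‖ * ‖landauMode n k z‖) ^ 2 + (√n * ‖landauMode (n - 1) k z‖) ^ 2) := add_sq_le
    _ = _ := by rw [mul_pow, mul_pow, Real.sq_sqrt (Nat.cast_nonneg _)]

lemma add_two_pow_mul_norm_landauMode_sq_le (p n k : ℕ) (z : ℂ) :
    ((k : ℝ) + 2) ^ (p + 1) * ‖landauMode n (k + 1) z‖ ^ 2 ≤
      2 ^ (p + 2) * (‖z‖ ^ 2 * (((k : ℝ) + 1) ^ p * ‖landauMode n k z‖ ^ 2) +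
        n * (((k : ℝ) + 1) ^ p * ‖landauMode (n - 1) k z‖ ^ 2)) :=
  calc ((k : ℝ) + 2) ^ (p + 1) * ‖landauMode n (k + 1) z‖ ^ 2
      ≤ (2 * ((k : ℝ) + 1)) ^ (p + 1) * ‖landauMode n (k + 1) z‖ ^ 2 := by
        gcongr
        linarith [k.cast_nonneg (α := ℝ)]
    _ = 2 ^ (p + 1) * ((k : ℝ) + 1) ^ p * (((k : ℝ) + 1) * ‖landauMode n (k + 1) z‖ ^ 2) := by
        rw [mul_pow]
        ring
    _ ≤ 2 ^ (p + 1) * ((k : ℝ) + 1) ^ p * (2 * (‖z‖ ^ 2 * ‖landauMode n k z‖ ^ 2 +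
          n * ‖landauMode (n - 1) k z‖ ^ 2)) :=
        mul_le_mul_of_nonneg_left (succ_mul_norm_landauMode_sq_le n k z) (by positivity)
    _ = _ := by ring

lemma sum_norm_landauMode_sq_le (n K : ℕ) (z : ℂ) :
    ∑ k ∈ Finset.range K, ‖landauMode n k z‖ ^ 2 ≤ Real.exp (‖z‖ ^ 2) :=
  sum_le_hasSum _ (fun _ _ => by positivity) (hasSum_norm_landauMode_sq n z)

lemma sum_pow_succ_mul_norm_landauMode_sq_le (p n K : ℕ) (z : ℂ) :
    ∑ k ∈ Finset.range K, ((k : ℝ) + 1) ^ (p + 1) * ‖landauMode n k z‖ ^ 2 ≤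
      2 ^ (p + 2) * (‖z‖ ^ 2 * ∑ k ∈ Finset.range K, ((k : ℝ) + 1) ^ p * ‖landauMode n k z‖ ^ 2 +
        n * ∑ k ∈ Finset.range K, ((k : ℝ) + 1) ^ p * ‖landauMode (n - 1) k z‖ ^ 2) +
      Real.exp (‖z‖ ^ 2) :=
  calc ∑ k ∈ Finset.range K, ((k : ℝ) + 1) ^ (p + 1) * ‖landauMode n k z‖ ^ 2
      ≤ ∑ k ∈ Finset.range (K + 1), ((k : ℝ) + 1) ^ (p + 1) * ‖landauMode n k z‖ ^ 2 :=
        Finset.sum_le_sum_of_subset_of_nonneg (Finset.range_mono K.le_succ)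
          fun _ _ _ => by positivity
    _ ≤ _ := by
        rw [Finset.sum_range_succ']
        refine add_le_add ?_ (by simpa using sum_norm_landauMode_sq_le n 1 z)
        simp only [Finset.mul_sum, ← Finset.sum_add_distrib]
        refine Finset.sum_le_sum fun k _ => ?_
        simpa [Finset.mul_sum, add_assoc, one_add_one_eq_two] using
          add_two_pow_mul_norm_landauMode_sq_le p n k z

lemma exists_sum_pow_mul_norm_landauMode_sq_le (p : ℕ) :
    ∃ C : ℝ, 0 ≤ C ∧ ∀ (n K : ℕ) (z : ℂ),
      ∑ k ∈ Finset.range K, ((k : ℝ) + 1) ^ p * ‖landauMode n k z‖ ^ 2 ≤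
        C * (1 + ‖z‖ ^ 2 + n) ^ p * Real.exp (‖z‖ ^ 2) := by
  induction p with
  | zero => exact ⟨1, zero_le_one, fun n K z => by simpa using sum_norm_landauMode_sq_le n K z⟩
  | succ p ih =>
    obtain ⟨C, hC, ih⟩ := ih
    refine ⟨2 ^ (p + 2) * C + 1, by positivity, fun n K z => ?_⟩
    have hX : 1 ≤ 1 + ‖z‖ ^ 2 + n := by linarith [sq_nonneg ‖z‖, n.cast_nonneg (α := ℝ)]
    have hpred : ∑ k ∈ Finset.range K, ((k : ℝ) + 1) ^ p * ‖landauMode (n - 1) k z‖ ^ 2 ≤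
        C * (1 + ‖z‖ ^ 2 + n) ^ p * Real.exp (‖z‖ ^ 2) := by
      refine (ih (n - 1) K z).trans ?_
      gcongr
      exact n.sub_le 1
    calc ∑ k ∈ Finset.range K, ((k : ℝ) + 1) ^ (p + 1) * ‖landauMode n k z‖ ^ 2
        ≤ 2 ^ (p + 2) * ((‖z‖ ^ 2 + n) * (C * (1 + ‖z‖ ^ 2 + n) ^ p * Real.exp (‖z‖ ^ 2))) +
            1 * Real.exp (‖z‖ ^ 2) := by
          rw [add_mul, one_mul]
          refine (sum_pow_succ_mul_norm_landauMode_sq_le p n K z).trans ?_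
          gcongr
          exact ih n K z
      _ ≤ 2 ^ (p + 2) * ((1 + ‖z‖ ^ 2 + n) * (C * (1 + ‖z‖ ^ 2 + n) ^ p * Real.exp (‖z‖ ^ 2))) +
            (1 + ‖z‖ ^ 2 + n) ^ (p + 1) * Real.exp (‖z‖ ^ 2) := by
          gcongr
          · linarith
          · exact one_le_pow₀ hX
      _ = (2 ^ (p + 2) * C + 1) * (1 + ‖z‖ ^ 2 + n) ^ (p + 1) * Real.exp (‖z‖ ^ 2) := by ring

/-! ### Level fields with deterministic coefficients -/

/-- The expansion of the `n`-th Landau level field over `landauMode n`, without the Gaussian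
weight. -/
def landauSeries (c : ℕ → ℂ) (n : ℕ) (z : ℂ) : ℂ :=
  ∑' k, c k * landauMode n k z

/-- The normalized field `φ_n(z) = e^{-|z|²/2} f_n(z)`. -/
def weightedField (c : ℕ → ℂ) (n : ℕ) (z : ℂ) : ℂ :=
  (Real.exp (-‖z‖ ^ 2 / 2) : ℂ) * landauField c n z

/-- The flux `2 √n conj(φ_n) φ_{n-1}` between consecutive levels, whose increments in `n` are the
gradients of `|φ_n|²`; it vanishes at `n = 0`. -/
def levelFlux (c : ℕ → ℂ) (n : ℕ) (z : ℂ) : ℂ :=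
  2 * (√n : ℂ) * (conj (weightedField c n z) * weightedField c (n - 1) z)

/-- The growth condition on the coefficients, satisfied almost surely by square integrable
identically distributed ones, under which all level fields converge. -/
def AdmissibleCoeff (c : ℕ → ℂ) : Prop :=
  Summable fun k : ℕ => ‖c k‖ ^ 2 / ((k : ℝ) + 1) ^ 2

lemma norm_exp_mul_sq (z w : ℂ) :
    ‖(Real.exp (-‖z‖ ^ 2 / 2) : ℂ) * w‖ ^ 2 = Real.exp (-‖z‖ ^ 2) * ‖w‖ ^ 2 := by
  rw [norm_mul, mul_pow, Complex.norm_of_nonneg (Real.exp_nonneg _), ← Real.exp_nat_mul]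
  ring_nf

lemma norm_weightedField_sq (c : ℕ → ℂ) (n : ℕ) (z : ℂ) :
    ‖weightedField c n z‖ ^ 2 = Real.exp (-‖z‖ ^ 2) * ‖landauField c n z‖ ^ 2 :=
  norm_exp_mul_sq z _

namespace AdmissibleCoeff

variable {c : ℕ → ℂ}

lemma exists_norm_le (hc : AdmissibleCoeff c) : ∃ A : ℝ, 0 ≤ A ∧ ∀ k, ‖c k‖ ≤ A * 2 ^ k := by
  refine ⟨√(∑' k : ℕ, ‖c k‖ ^ 2 / ((k : ℝ) + 1) ^ 2), Real.sqrt_nonneg _, fun k => ?_⟩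
  have hterm : (‖c k‖ / ((k : ℝ) + 1)) ^ 2 ≤ ∑' k : ℕ, ‖c k‖ ^ 2 / ((k : ℝ) + 1) ^ 2 := by
    rw [div_pow]
    exact hc.le_tsum k fun _ _ => by positivity
  have hk : (k : ℝ) + 1 ≤ 2 ^ k := by exact_mod_cast Nat.lt_two_pow_self
  calc ‖c k‖ ≤ √(∑' k : ℕ, ‖c k‖ ^ 2 / ((k : ℝ) + 1) ^ 2) * ((k : ℝ) + 1) :=
        (div_le_iff₀ (by positivity)).1 (Real.le_sqrt_of_sq_le hterm)
    _ ≤ _ := by gcongr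

lemma exists_summable_bound (hc : AdmissibleCoeff c) (n : ℕ) {R : ℝ} (hR : 1 ≤ R) :
    ∃ u : ℕ → ℝ, Summable u ∧ ∀ k, ∀ z ∈ ball (0 : ℂ) R, ‖c k * landauMode n k z‖ ≤ u k := by
  obtain ⟨A, hA, hcA⟩ := hc.exists_norm_le
  refine ⟨fun k => A * (2 * R) ^ n * ((2 * (2 ^ n * R)) ^ k / √(k.factorial : ℝ)),
    (summable_pow_div_sqrt_factorial _).mul_left _, fun k z hz => ?_⟩
  calc ‖c k * landauMode n k z‖
      ≤ (A * 2 ^ k) * ((2 * R) ^ n * ((2 ^ n * R) ^ k / √(k.factorial : ℝ))) := by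
        rw [norm_mul]
        gcongr
        exacts [hcA k, norm_landauMode_le hR (mem_ball_zero_iff.1 hz).le n k]
    _ = _ := by
        rw [mul_pow 2]
        ring

lemma summable_mul_landauMode (hc : AdmissibleCoeff c) (n : ℕ) (z : ℂ) :
    Summable fun k => c k * landauMode n k z := by
  obtain ⟨u, hu, hbound⟩ := hc.exists_summable_bound n (R := 1 + ‖z‖) (by simp)
  exact hu.of_norm_bounded fun k => hbound k z (by simp)

lemma summable_gefTerm (hc : AdmissibleCoeff c) (z : ℂ) : Summable (gefTerm c z) :=
  hc.summable_mul_landauMode 0 z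

lemma hasFDerivAt_landauSeries (hc : AdmissibleCoeff c) (n : ℕ) (z : ℂ) :
    HasFDerivAt (landauSeries c n)
      (wirtingerCLM ((√(n + 1 : ℕ) : ℂ) * landauSeries c (n + 1) z + conj z * landauSeries c n z)
        (-((√n : ℂ) * landauSeries c (n - 1) z))) z := by
  have hR : 1 ≤ 1 + ‖z‖ := by simp
  obtain ⟨u, hu, hfu⟩ := hc.exists_summable_bound n hR
  obtain ⟨v, hv, hfv⟩ := hc.exists_summable_bound (n + 1) hR
  obtain ⟨w, hw, hfw⟩ := hc.exists_summable_bound (n - 1) hR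
  have hsum (m : ℕ) := hc.summable_mul_landauMode m z
  have hderiv := hasFDerivAt_tsum_of_wirtinger_bound (z := z) isOpen_ball
    (convex_ball (0 : ℂ) (1 + ‖z‖)).isPreconnected
    (f := fun k z => c k * landauMode n k z)
    (a := fun k z => (√(n + 1 : ℕ) : ℂ) * (c k * landauMode (n + 1) k z) +
      conj z * (c k * landauMode n k z))
    (b := fun k z => -((√n : ℂ) * (c k * landauMode (n - 1) k z)))
    hu ((hv.mul_left √(n + 1 : ℕ)).add (hu.mul_left (1 + ‖z‖))) (hw.mul_left √n)
    hfu (fun k x hx => ?_) (fun k x hx => ?_) (fun k x _ => ?_) (by simp)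
  · rw [((hsum _).mul_left _).tsum_add ((hsum _).mul_left _), tsum_neg, tsum_mul_left,
      tsum_mul_left, tsum_mul_left] at hderiv
    exact hderiv
  · refine (norm_add_le _ _).trans ?_
    rw [norm_mul, norm_mul (conj x), Complex.norm_of_nonneg (Real.sqrt_nonneg _), RCLike.norm_conj]
    gcongr
    exacts [hfv k x hx, (mem_ball_zero_iff.1 hx).le, hfu k x hx]
  · rw [norm_neg, norm_mul, Complex.norm_of_nonneg (Real.sqrt_nonneg _)]
    gcongr
    exact hfw k x hx
  · refine ((hasFDerivAt_landauMode n k x).const_mul (c k)).congr_fderiv ?_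
    ext v
    simp only [smul_apply, wirtingerCLM_apply, smul_eq_mul]
    linear_combination (-c k * v) * sqrt_succ_mul_landauMode_succ n k x

lemma raising_iterate_gef (hc : AdmissibleCoeff c) (n : ℕ) (z : ℂ) :
    raising^[n] (gef c) z = (√(n.factorial : ℝ) : ℂ) * landauSeries c n z := by
  induction n generalizing z with
  | zero => simp [landauSeries, landauMode, gef, gefTerm]
  | succ n ih =>
    have hderiv := (hc.hasFDerivAt_landauSeries n z).const_mul (√(n.factorial : ℝ) : ℂ)
    rw [smul_wirtingerCLM] at hderiv
    rw [Function.iterate_succ_apply', raising, funext ih, dz_eq_of_hasFDerivAt hderiv,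
      sqrt_factorial_succ, Complex.ofReal_mul]
    ring

lemma landauField_eq (hc : AdmissibleCoeff c) (n : ℕ) : landauField c n = landauSeries c n := by
  funext z
  rw [landauField, hc.raising_iterate_gef, ← mul_assoc,
    one_div_mul_cancel (ofReal_sqrt_factorial_ne_zero n), one_mul]

lemma hasSum_landauField (hc : AdmissibleCoeff c) (n : ℕ) (z : ℂ) :
    HasSum (fun k => c k * landauMode n k z) (landauField c n z) := by
  rw [hc.landauField_eq]
  exact (hc.summable_mul_landauMode n z).hasSum

lemma hasGradientAt_norm_weightedField_sq (hc : AdmissibleCoeff c) (n : ℕ) (z : ℂ) :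
    HasGradientAt (fun z => ‖weightedField c n z‖ ^ 2)
      (levelFlux c (n + 1) z - levelFlux c n z) z := by
  have hgrad := hasGradientAt_exp_mul_norm_sq (hc.hasFDerivAt_landauSeries n z)
  have hexp : (Real.exp (-‖z‖ ^ 2) : ℂ) = (Real.exp (-‖z‖ ^ 2 / 2) : ℂ) ^ 2 := by
    rw [← Complex.ofReal_pow, ← Real.exp_nat_mul]
    ring_nf
  simp only [norm_weightedField_sq, hc.landauField_eq]
  convert hgrad using 1
  simp only [levelFlux, weightedField, hc.landauField_eq, Nat.add_sub_cancel, map_add, map_mul,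
    Complex.conj_ofReal, Complex.conj_conj, hexp]
  rw [← Complex.conj_mul']
  ring

lemma hasGradientAt_averagedField (hc : AdmissibleCoeff c) (N : ℕ) (z : ℂ) :
    HasGradientAt (averagedField c N) ((1 / N : ℝ) • levelFlux c N z) z := by
  have hsum := hasGradientAt_const_mul (1 / N : ℝ) (hasGradientAt_fun_sum (s := Finset.range N)
    fun n _ => hc.hasGradientAt_norm_weightedField_sq n z)
  have hzero : levelFlux c 0 z = 0 := by simp [levelFlux]
  rw [Finset.sum_range_sub (levelFlux c · z), hzero, sub_zero] at hsum
  exact hsum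

-- A crude bound, good enough to interpolate between the points of a polynomially fine net.
lemma exists_norm_weightedField_sq_le (hc : AdmissibleCoeff c) :
    ∃ C : ℝ, 0 ≤ C ∧ ∀ n z, ‖weightedField c n z‖ ^ 2 ≤ C * (1 + ‖z‖ ^ 2 + n) ^ 2 := by
  obtain ⟨C, hC, hmoment⟩ := exists_sum_pow_mul_norm_landauMode_sq_le 2
  set T := ∑' k : ℕ, ‖c k‖ ^ 2 / ((k : ℝ) + 1) ^ 2
  have hpartial (n K : ℕ) (z : ℂ) : ‖∑ k ∈ Finset.range K, c k * landauMode n k z‖ ^ 2 ≤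
      T * (C * (1 + ‖z‖ ^ 2 + n) ^ 2 * Real.exp (‖z‖ ^ 2)) :=
    calc ‖∑ k ∈ Finset.range K, c k * landauMode n k z‖ ^ 2
        ≤ (∑ k ∈ Finset.range K, ‖c k‖ / ((k : ℝ) + 1) *
            (((k : ℝ) + 1) * ‖landauMode n k z‖)) ^ 2 := by
          gcongr
          refine norm_sum_le_of_le _ fun k _ => le_of_eq ?_
          rw [norm_mul]
          field_simp
      _ ≤ (∑ k ∈ Finset.range K, (‖c k‖ / ((k : ℝ) + 1)) ^ 2) *
            ∑ k ∈ Finset.range K, (((k : ℝ) + 1) * ‖landauMode n k z‖) ^ 2 :=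
          Finset.sum_mul_sq_le_sq_mul_sq _ _ _
      _ ≤ _ := by
          simp only [mul_pow _ ‖landauMode _ _ _‖, div_pow]
          gcongr
          exacts [hc.sum_le_tsum _ fun _ _ => by positivity, hmoment n K z]
  refine ⟨T * C, by positivity, fun n z => ?_⟩
  have hfield : ‖landauField c n z‖ ^ 2 ≤ T * (C * (1 + ‖z‖ ^ 2 + n) ^ 2 * Real.exp (‖z‖ ^ 2)) :=
    le_of_tendsto ((hc.hasSum_landauField n z).tendsto_sum_nat.norm.pow 2)
      (.of_forall fun K => hpartial n K z)
  rw [norm_weightedField_sq, Real.exp_neg]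
  calc (Real.exp (‖z‖ ^ 2))⁻¹ * ‖landauField c n z‖ ^ 2
      ≤ (Real.exp (‖z‖ ^ 2))⁻¹ * (T * (C * (1 + ‖z‖ ^ 2 + n) ^ 2 * Real.exp (‖z‖ ^ 2))) := by gcongr
    _ = T * C * (1 + ‖z‖ ^ 2 + n) ^ 2 := by field_simp

lemma averagedField_apply_zero (hc : AdmissibleCoeff c) (N : ℕ) :
    averagedField c N 0 = (∑ n ∈ Finset.range N, ‖c n‖ ^ 2) / N := by
  have hmode (n : ℕ) : landauField c n 0 = c n := by
    simp [hc.landauField_eq, landauSeries, landauMode_apply_zero]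
  simp [averagedField, hmode, div_eq_inv_mul]

end AdmissibleCoeff

/-! ### Lipschitz functions and Hölder convergence -/

lemma holderSeminorm_mono {α : ℝ} {K s : Set ℂ} (hKs : K ⊆ s) (u : ℂ → ℝ) :
    holderSeminorm α K u ≤ holderSeminorm α s u :=
  (biSup_mono fun _ h => hKs h).trans (iSup₂_mono fun _ _ => biSup_mono fun _ h => hKs h)

lemma TendstoHolder.mono {α : ℝ} {K s : Set ℂ} {u : ℕ → ℂ → ℝ} {v : ℂ → ℝ}
    (h : TendstoHolder α s u v) (hKs : K ⊆ s) : TendstoHolder α K u v := by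
  have hmem {f : ℂ → ℝ} (hf : MemHolderSpace α s f) : MemHolderSpace α K f :=
    ⟨hf.1.mono hKs, (holderSeminorm_mono hKs f).trans_lt hf.2⟩
  refine ⟨fun N => hmem (h.1 N), hmem h.2.1, tendsto_of_tendsto_of_tendsto_of_le_of_le
    tendsto_const_nhds h.2.2 (fun _ => zero_le) fun N => ?_⟩
  exact add_le_add (biSup_mono fun _ hz => hKs hz) (holderSeminorm_mono hKs _)

section Lipschitz

variable {α : ℝ} (hα : α ≤ 1) {s : Set ℂ} (hs : Bornology.IsBounded s)

include hα hs

lemma holderSeminorm_le_of_lipschitzOnWith {L : ℝ≥0} {u : ℂ → ℝ} (hu : LipschitzOnWith L u s) :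
    holderSeminorm α s u ≤ ENNReal.ofReal (L * diam s ^ (1 - α)) := by
  refine iSup₂_le fun z hz => iSup₂_le fun w hw => iSup_le fun hzw =>
    ENNReal.ofReal_le_ofReal ?_
  have hpos : 0 < ‖z - w‖ := norm_sub_pos_iff.2 hzw
  have hdiam : ‖z - w‖ ≤ diam s := by simpa [dist_eq_norm] using dist_le_diam_of_mem hs hz hw
  rw [div_le_iff₀ (by positivity)]
  calc |u z - u w| ≤ L * ‖z - w‖ := by simpa [dist_eq_norm] using hu.dist_le_mul z hz w hw
    _ = L * ‖z - w‖ ^ (1 - α) * ‖z - w‖ ^ α := by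
        rw [mul_assoc, ← Real.rpow_add hpos, sub_add_cancel, Real.rpow_one]
    _ ≤ L * diam s ^ (1 - α) * ‖z - w‖ ^ α := by
        gcongr

lemma memHolderSpace_of_lipschitzOnWith {L : ℝ≥0} {u : ℂ → ℝ} (hu : LipschitzOnWith L u s) :
    MemHolderSpace α s u :=
  ⟨hu.continuousOn, (holderSeminorm_le_of_lipschitzOnWith hα hs hu).trans_lt
    ENNReal.ofReal_lt_top⟩

lemma holderNorm_sub_const_le_of_lipschitzOnWith {L : ℝ≥0} {u : ℂ → ℝ}
    (hu : LipschitzOnWith L u s) {z₀ : ℂ} (hz₀ : z₀ ∈ s) (a : ℝ) :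
    holderNorm α s (fun z => u z - a) ≤
      ENNReal.ofReal (L * diam s + |u z₀ - a|) + ENNReal.ofReal (L * diam s ^ (1 - α)) := by
  have hu' : LipschitzOnWith L (fun z => u z - a) s := fun z hz w hw => by
    simpa only [edist_sub_right] using hu hz hw
  refine add_le_add (iSup₂_le fun z hz => ENNReal.ofReal_le_ofReal ?_)
    (holderSeminorm_le_of_lipschitzOnWith hα hs hu')
  calc |u z - a| ≤ |u z - u z₀| + |u z₀ - a| := abs_sub_le _ _ _
    _ ≤ L * diam s + |u z₀ - a| := by
        gcongr
        refine (hu.dist_le_mul z hz z₀ hz₀).trans ?_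
        gcongr
        exact dist_le_diam_of_mem hs hz hz₀

lemma tendstoHolder_const_of_lipschitzOnWith {u : ℕ → ℂ → ℝ} {L : ℕ → ℝ≥0}
    (hlip : ∀ N, ∃ C, LipschitzOnWith C (u N) s)
    (hL : ∀ᶠ N in atTop, LipschitzOnWith (L N) (u N) s) (hL0 : Tendsto L atTop (𝓝 0))
    {z₀ : ℂ} (hz₀ : z₀ ∈ s) {a : ℝ} (ha : Tendsto (fun N => u N z₀) atTop (𝓝 a)) :
    TendstoHolder α s u fun _ => a := by
  refine ⟨fun N => (hlip N).elim fun C => memHolderSpace_of_lipschitzOnWith hα hs,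
    memHolderSpace_of_lipschitzOnWith hα hs ((LipschitzWith.const a).lipschitzOnWith (s := s)), ?_⟩
  have hL0' : Tendsto (fun N => (L N : ℝ)) atTop (𝓝 0) := NNReal.tendsto_coe.2 hL0
  have hbound : Tendsto (fun N => ENNReal.ofReal (L N * diam s + |u N z₀ - a|) +
      ENNReal.ofReal (L N * diam s ^ (1 - α))) atTop (𝓝 0) := by
    simpa using (ENNReal.tendsto_ofReal ((hL0'.mul_const _).add (ha.sub_const a).abs)).add
      (ENNReal.tendsto_ofReal (hL0'.mul_const _))
  refine tendsto_of_tendsto_of_tendsto_of_le_of_le' tendsto_const_nhds hbound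
    (.of_forall fun _ => zero_le) ?_
  filter_upwards [hL] with N hN
  exact holderNorm_sub_const_le_of_lipschitzOnWith hα hs hN hz₀ a

end Lipschitz

lemma norm_levelFlux_le {c : ℕ → ℂ} {n : ℕ} {z : ℂ} {M : ℝ} (hn : ‖weightedField c n z‖ ^ 2 ≤ M)
    (hpred : ‖weightedField c (n - 1) z‖ ^ 2 ≤ M) : ‖levelFlux c n z‖ ≤ 2 * √n * M := by
  rw [levelFlux, norm_mul, norm_mul, norm_mul, RCLike.norm_conj, Complex.norm_ofNat,
    Complex.norm_of_nonneg (Real.sqrt_nonneg _)]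
  gcongr
  linarith [two_mul_le_add_sq ‖weightedField c n z‖ ‖weightedField c (n - 1) z‖]

lemma tendsto_log_add_one_div_sqrt :
    Tendsto (fun n : ℕ => Real.log (n + 1) / √n) atTop (𝓝 0) := by
  have hsqrt : Tendsto (fun n : ℕ => √(n : ℝ)) atTop atTop :=
    Real.tendsto_sqrt_atTop.comp tendsto_natCast_atTop_atTop
  have hlog : Tendsto (fun n : ℕ => Real.log n / √n) atTop (𝓝 0) := by
    simpa only [Real.sqrt_eq_rpow, Function.comp_apply] using
      ((isLittleO_log_rpow_atTop one_half_pos).comp_tendsto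
        tendsto_natCast_atTop_atTop).tendsto_div_nhds_zero
  refine (zero_add (0 : ℝ) ▸
    (Real.tendsto_log_nat_add_one_sub_log.div_atTop hsqrt).add hlog).congr fun n => ?_
  rw [← add_div, sub_add_cancel]

namespace AdmissibleCoeff

variable {c : ℕ → ℂ}

lemma lipschitzOnWith_averagedField (hc : AdmissibleCoeff c) {s : Set ℂ} (hs : Convex ℝ s)
    {N : ℕ} {M : ℝ} (hN : ∀ z ∈ s, ‖weightedField c N z‖ ^ 2 ≤ M)
    (hpred : ∀ z ∈ s, ‖weightedField c (N - 1) z‖ ^ 2 ≤ M) :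
    LipschitzOnWith (2 * M / √N).toNNReal (averagedField c N) s := by
  refine .of_dist_le' fun z hz w hw => ?_
  rw [Real.dist_eq, dist_eq_norm]
  refine abs_sub_le_of_hasGradientAt_of_norm_le hs
    (fun x _ => hc.hasGradientAt_averagedField N x) (fun x hx => ?_) hz hw
  rw [norm_smul, Real.norm_of_nonneg (by positivity)]
  calc 1 / N * ‖levelFlux c N x‖ ≤ 1 / N * (2 * √N * M) := by
        gcongr
        exact norm_levelFlux_le (hN x hx) (hpred x hx)
    _ = 2 * M * (√N / N) := by ring
    _ = 2 * M / √N := by rw [Real.sqrt_div_self', mul_one_div]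

lemma exists_norm_weightedField_sq_le_on_closedBall (hc : AdmissibleCoeff c) (R : ℝ) :
    ∃ C : ℝ, 0 ≤ C ∧
      ∀ n : ℕ, ∀ z ∈ closedBall (0 : ℂ) R, ‖weightedField c n z‖ ^ 2 ≤ C * (n + 1) ^ 2 := by
  obtain ⟨C, hC, hgrowth⟩ := hc.exists_norm_weightedField_sq_le
  refine ⟨C * (1 + R ^ 2) ^ 2, by positivity, fun n z hz => (hgrowth n z).trans ?_⟩
  rw [mul_assoc, ← mul_pow]
  gcongr
  have hz' : ‖z‖ ^ 2 ≤ R ^ 2 := by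
    gcongr
    exact mem_closedBall_zero_iff.1 hz
  nlinarith [mul_nonneg (sq_nonneg R) (n.cast_nonneg (α := ℝ))]

lemma exists_abs_norm_weightedField_sq_sub_le (hc : AdmissibleCoeff c) (R : ℝ) :
    ∃ C : ℝ, 0 ≤ C ∧ ∀ n : ℕ, ∀ z ∈ closedBall (0 : ℂ) R, ∀ w ∈ closedBall (0 : ℂ) R,
      |‖weightedField c n z‖ ^ 2 - ‖weightedField c n w‖ ^ 2| ≤ C * (n + 1) ^ 3 * ‖z - w‖ := by
  obtain ⟨C, hC, hgrowth⟩ := hc.exists_norm_weightedField_sq_le_on_closedBall R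
  refine ⟨32 * C, by positivity, fun n z hz w hw =>
    abs_sub_le_of_hasGradientAt_of_norm_le (convex_closedBall 0 R)
      (fun x _ => hc.hasGradientAt_norm_weightedField_sq n x) (fun x hx => ?_) hz hw⟩
  have hlevel {j : ℕ} (hj : j ≤ n + 1) : ‖weightedField c j x‖ ^ 2 ≤ C * (2 * (n + 1)) ^ 2 := by
    have hj' : (j : ℝ) ≤ n + 1 := by exact_mod_cast hj
    refine (hgrowth j x hx).trans ?_
    gcongr
    linarith [n.cast_nonneg (α := ℝ)]
  have hflux {m : ℕ} (hm : m ≤ n + 1) :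
      ‖levelFlux c m x‖ ≤ 2 * (2 * (n + 1)) * (C * (2 * (n + 1)) ^ 2) := by
    have hsqrt : √(m : ℝ) ≤ 2 * (n + 1) := by
      have hm' : (m : ℝ) ≤ n + 1 := by exact_mod_cast hm
      rw [Real.sqrt_le_left (by positivity)]
      nlinarith [n.cast_nonneg (α := ℝ)]
    refine (norm_levelFlux_le (hlevel hm) (hlevel (by omega : m - 1 ≤ n + 1))).trans ?_
    gcongr
  calc _ ≤ _ := norm_sub_le _ _
    _ ≤ _ := add_le_add (hflux le_rfl) (hflux n.le_succ)
    _ = 32 * C * (n + 1) ^ 3 := by ring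

lemma tendstoHolder_averagedField (hc : AdmissibleCoeff c) {α : ℝ} (hα : α ≤ 1) {R : ℝ}
    (hR : 0 ≤ R) {A : ℝ} (hA : 0 ≤ A) (hlog : ∀ᶠ n : ℕ in atTop, ∀ z ∈ closedBall (0 : ℂ) R,
      ‖weightedField c n z‖ ^ 2 ≤ A * Real.log (n + 1))
    {a : ℝ} (ha : Tendsto (fun N : ℕ => (∑ n ∈ Finset.range N, ‖c n‖ ^ 2) / N) atTop (𝓝 a)) :
    TendstoHolder α (closedBall 0 R) (averagedField c) fun _ => a := by
  refine tendstoHolder_const_of_lipschitzOnWith hα isBounded_closedBall (fun N => ?_)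
    (L := fun N => (2 * (A * Real.log (N + 1)) / √N).toNNReal) ?_ ?_
    (mem_closedBall_self hR) ?_
  · obtain ⟨C, hC, hgrowth⟩ := hc.exists_norm_weightedField_sq_le_on_closedBall R
    refine ⟨_, hc.lipschitzOnWith_averagedField (convex_closedBall 0 R) (hgrowth N) fun z hz =>
      (hgrowth (N - 1) z hz).trans ?_⟩
    gcongr
    exact N.sub_le 1
  · filter_upwards [hlog, (tendsto_sub_atTop_nat 1).eventually hlog] with N hN hpred
    refine hc.lipschitzOnWith_averagedField (convex_closedBall 0 R) hN fun z hz =>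
      (hpred z hz).trans ?_
    gcongr
    exact N.sub_le 1
  · rw [← Real.toNNReal_zero]
    refine tendsto_real_toNNReal ?_
    simpa only [mul_zero, mul_div_assoc, mul_assoc] using
      tendsto_log_add_one_div_sqrt.const_mul (2 * A)
  · simpa only [hc.averagedField_apply_zero] using ha

end AdmissibleCoeff

lemma exists_int_abs_sub_div_le {R m : ℕ} (hm : 0 < m) {x : ℝ} (hx : |x| ≤ R) :
    ∃ i ∈ Finset.Icc (-(R * m : ℤ)) (R * m), |x - i / m| ≤ 1 / m := by
  have hm' : (0 : ℝ) < m := by exact_mod_cast hm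
  have hxm : |x * m| ≤ R * m := by
    rw [abs_mul, Nat.abs_cast]
    gcongr
  obtain ⟨hlower, hupper⟩ := abs_le.1 hxm
  refine ⟨⌊x * m⌋, Finset.mem_Icc.2 ⟨Int.le_floor.2 (by exact_mod_cast hlower), ?_⟩, ?_⟩
  · exact_mod_cast (Int.floor_le (x * m)).trans hupper
  · have hfract : x - (⌊x * m⌋ : ℝ) / m = Int.fract (x * m) / m := by
      rw [Int.fract, sub_div, mul_div_cancel_right₀ _ hm'.ne']
    rw [hfract, abs_div, Nat.abs_cast, Int.abs_fract]
    gcongr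
    exact (Int.fract_lt_one _).le

lemma exists_finset_net_closedBall (R : ℕ) {m : ℕ} (hm : 0 < m) :
    ∃ s : Finset ℂ, s.card ≤ ((2 * R + 1) * m) ^ 2 ∧
      ∀ z ∈ closedBall (0 : ℂ) R, ∃ p ∈ s, ‖z - p‖ ≤ 2 / m := by
  set I : Finset ℤ := Finset.Icc (-(R * m : ℤ)) (R * m)
  have hI : I.card ≤ (2 * R + 1) * m := by
    rw [Int.card_Icc, Int.toNat_le]
    push_cast
    linarith [(by exact_mod_cast hm : (1 : ℤ) ≤ m)]
  refine ⟨(I ×ˢ I).image fun p => (⟨p.1 / m, p.2 / m⟩ : ℂ), ?_, fun z hz => ?_⟩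
  · calc _ ≤ (I ×ˢ I).card := Finset.card_image_le
      _ = I.card ^ 2 := by rw [Finset.card_product, sq]
      _ ≤ _ := by gcongr
  · rw [mem_closedBall_zero_iff] at hz
    obtain ⟨i, hi, hre⟩ := exists_int_abs_sub_div_le hm ((Complex.abs_re_le_norm z).trans hz)
    obtain ⟨j, hj, him⟩ := exists_int_abs_sub_div_le hm ((Complex.abs_im_le_norm z).trans hz)
    refine ⟨_, Finset.mem_image_of_mem _ (Finset.mk_mem_product hi hj), ?_⟩
    calc _ ≤ _ := Complex.norm_le_abs_re_add_abs_im _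
      _ ≤ 1 / m + 1 / m := add_le_add hre him
      _ = 2 / m := by ring

-- The mesh `(n + 1)⁻³` compensates the growth of the gradient of `|φ_n|²`.
lemma AdmissibleCoeff.eventually_norm_weightedField_sq_le_of_net {c : ℕ → ℂ}
    (hc : AdmissibleCoeff c) {R A : ℝ} {net : ℕ → Finset ℂ}
    (hnet : ∀ n, ∀ z ∈ closedBall (0 : ℂ) R, ∃ p ∈ net n, ‖z - p‖ ≤ 2 / ((n + 1) ^ 3 : ℕ))
    (hA : ∀ᶠ n : ℕ in atTop, ∀ p ∈ net n, ‖weightedField c n p‖ ^ 2 ≤ A * Real.log (n + 1)) :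
    ∀ᶠ n : ℕ in atTop, ∀ z ∈ closedBall (0 : ℂ) R,
      ‖weightedField c n z‖ ^ 2 ≤ (A + 1) * Real.log (n + 1) := by
  obtain ⟨C, hC, hlip⟩ := hc.exists_abs_norm_weightedField_sq_sub_le (R + 2)
  have hlog : Tendsto (fun n : ℕ => Real.log (n + 1)) atTop atTop :=
    Real.tendsto_log_atTop.comp (tendsto_natCast_atTop_atTop.atTop_add tendsto_const_nhds)
  filter_upwards [hA, hlog.eventually_ge_atTop (2 * C)] with n hn hlogn z hz
  obtain ⟨p, hp, hzp⟩ := hnet n z hz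
  rw [mem_closedBall_zero_iff] at hz
  have hmesh : ‖z - p‖ ≤ 2 :=
    hzp.trans (div_le_self zero_le_two (by exact_mod_cast Nat.one_le_pow _ _ n.succ_pos))
  have hpR : p ∈ closedBall (0 : ℂ) (R + 2) := by
    rw [mem_closedBall_zero_iff]
    linarith [norm_le_norm_add_norm_sub' p z, norm_sub_rev z p]
  have hosc : |‖weightedField c n z‖ ^ 2 - ‖weightedField c n p‖ ^ 2| ≤ 2 * C :=
    calc _ ≤ C * (n + 1) ^ 3 * ‖z - p‖ :=
          hlip n z (mem_closedBall_zero_iff.2 (by linarith)) p hpR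
      _ ≤ C * (n + 1) ^ 3 * (2 / ((n + 1) ^ 3 : ℕ)) := by gcongr
      _ = 2 * C := by
          push_cast
          field_simp
  linarith [hn p hp, (abs_le.1 hosc).2]

/-! ### Sub-Gaussian variables and the complex Gaussian law -/

section SubGaussian

variable {Ω : Type*} [MeasurableSpace Ω] {P : Measure Ω}

lemma hasSubgaussianMGF_mono {X : Ω → ℝ} {c d : ℝ≥0} (hX : HasSubgaussianMGF X c P)
    (hcd : c ≤ d) : HasSubgaussianMGF X d P :=
  ⟨hX.integrable_exp_mul, fun t => (hX.mgf_le t).trans (by gcongr)⟩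

lemma hasSubgaussianMGF_of_tendsto_ae {X : ℕ → Ω → ℝ} {Y : Ω → ℝ} {c : ℝ≥0}
    (hX : ∀ n, HasSubgaussianMGF (X n) c P)
    (hlim : ∀ᵐ ω ∂P, Tendsto (fun n => X n ω) atTop (𝓝 (Y ω))) : HasSubgaussianMGF Y c P := by
  have hlim_exp (t : ℝ) : ∀ᵐ ω ∂P, Tendsto (fun n => Real.exp (t * X n ω)) atTop
      (𝓝 (Real.exp (t * Y ω))) := by
    filter_upwards [hlim] with ω hω using (hω.const_mul t).rexp
  have hmgf (n : ℕ) (t : ℝ) :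
      ∫⁻ ω, ENNReal.ofReal (Real.exp (t * X n ω)) ∂P ≤
        ENNReal.ofReal (Real.exp (c * t ^ 2 / 2)) := by
    rw [← ofReal_integral_eq_lintegral_ofReal ((hX n).integrable_exp_mul t)
      (ae_of_all _ fun _ => Real.exp_nonneg _)]
    exact ENNReal.ofReal_le_ofReal ((hX n).mgf_le t)
  have hfatou (t : ℝ) :
      ∫⁻ ω, ENNReal.ofReal (Real.exp (t * Y ω)) ∂P ≤ ENNReal.ofReal (Real.exp (c * t ^ 2 / 2)) :=
    calc _ = ∫⁻ ω, liminf (fun n => ENNReal.ofReal (Real.exp (t * X n ω))) atTop ∂P :=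
          lintegral_congr_ae <| (hlim_exp t).mono fun ω hω =>
            (ENNReal.tendsto_ofReal hω).liminf_eq.symm
      _ ≤ liminf (fun n => ∫⁻ ω, ENNReal.ofReal (Real.exp (t * X n ω)) ∂P) atTop :=
          lintegral_liminf_le' fun n =>
            ((hX n).integrable_exp_mul t).aemeasurable.ennreal_ofReal
      _ ≤ _ := (liminf_le_liminf (.of_forall fun n => hmgf n t)).trans (liminf_const _).le
  have hmeas (t : ℝ) : AEStronglyMeasurable (fun ω => Real.exp (t * Y ω)) P :=
    aestronglyMeasurable_of_tendsto_ae _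
      (fun n => ((hX n).integrable_exp_mul t).aestronglyMeasurable) (hlim_exp t)
  refine ⟨fun t => ⟨hmeas t, ?_⟩, fun t => ?_⟩
  · rw [hasFiniteIntegral_iff_ofReal (ae_of_all _ fun _ => Real.exp_nonneg _)]
    exact (hfatou t).trans_lt ENNReal.ofReal_lt_top
  · rw [mgf, integral_eq_lintegral_of_nonneg_ae (ae_of_all _ fun _ => Real.exp_nonneg _) (hmeas t)]
    exact ENNReal.toReal_le_of_le_ofReal (Real.exp_nonneg _) (hfatou t)

lemma measureReal_two_mul_sq_lt_norm_sq_le [IsFiniteMeasure P] {Y : Ω → ℂ} {c : ℝ≥0}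
    (hY : ∀ u : ℂ, ‖u‖ = 1 → HasSubgaussianMGF (fun ω => (Y ω * u).re) c P) {t : ℝ} (ht : 0 ≤ t) :
    P.real {ω | 2 * t ^ 2 < ‖Y ω‖ ^ 2} ≤ 4 * Real.exp (-t ^ 2 / (2 * c)) := by
  set E : ℂ → Set Ω := fun u => {ω | t ≤ (Y ω * u).re}
  have hE (u : ℂ) (hu : ‖u‖ = 1) : P.real (E u) ≤ Real.exp (-t ^ 2 / (2 * c)) :=
    (hY u hu).measure_ge_le ht
  have hsub : {ω | 2 * t ^ 2 < ‖Y ω‖ ^ 2} ⊆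
      E 1 ∪ E (-1) ∪ (E Complex.I ∪ E (-Complex.I)) := by
    intro ω hω
    by_contra hcon
    simp only [E, Set.mem_union, Set.mem_ofPred_eq, not_or, not_le, Complex.mul_re,
      Complex.neg_re, Complex.neg_im, Complex.one_re, Complex.one_im, Complex.I_re,
      Complex.I_im] at hcon hω
    obtain ⟨⟨hre, hre'⟩, him, him'⟩ := hcon
    rw [← Complex.normSq_eq_norm_sq, Complex.normSq_apply] at hω
    nlinarith
  calc _ ≤ P.real (E 1 ∪ E (-1) ∪ (E Complex.I ∪ E (-Complex.I))) := measureReal_mono hsub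
    _ ≤ (P.real (E 1) + P.real (E (-1))) + (P.real (E Complex.I) + P.real (E (-Complex.I))) :=
        (measureReal_union_le _ _).trans
          (add_le_add (measureReal_union_le _ _) (measureReal_union_le _ _))
    _ ≤ 4 * Real.exp (-t ^ 2 / (2 * c)) := by
        linarith [hE 1 (by simp), hE (-1) (by simp), hE Complex.I (by simp),
          hE (-Complex.I) (by simp)]

lemma hasSubgaussianMGF_of_hasLaw_gaussianReal {X : Ω → ℝ} {v : ℝ≥0}
    (hX : HasLaw X (gaussianReal 0 v) P) : HasSubgaussianMGF X v P := by
  refine ⟨fun t => ?_, fun t => ?_⟩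
  · exact (hX.map_eq ▸ integrable_exp_mul_gaussianReal t).comp_aemeasurable hX.aemeasurable
  · rw [mgf_gaussianReal hX.map_eq, zero_mul, zero_add]

lemma integrable_sq_of_hasLaw_gaussianReal {X : Ω → ℝ} {v : ℝ≥0}
    (hX : HasLaw X (gaussianReal 0 v) P) : Integrable (fun ω => X ω ^ 2) P :=
  ((hasSubgaussianMGF_of_hasLaw_gaussianReal hX).memLp 2).integrable_sq

lemma integral_sq_of_hasLaw_gaussianReal {X : Ω → ℝ} {v : ℝ≥0}
    (hX : HasLaw X (gaussianReal 0 v) P) : ∫ ω, X ω ^ 2 ∂P = v := by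
  rw [← variance_of_integral_eq_zero hX.aemeasurable (by simp [hX.integral_eq]), hX.variance_eq,
    variance_id_gaussianReal]

end SubGaussian

section ComplexGaussian

lemma map_re_mul_stdComplexGaussian (a : ℂ) :
    stdComplexGaussian.map (fun z => (z * a).re) = gaussianReal 0 (‖a‖₊ ^ 2 / 2) := by
  have hmk : Measurable fun p : ℝ × ℝ => (⟨p.1, p.2⟩ : ℂ) :=
    Complex.measurableEquivRealProd.symm.measurable
  rw [stdComplexGaussian, Measure.map_map (by fun_prop) hmk]
  set γ : Measure ℝ := gaussianReal 0 (1 / 2)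
  have hfst : HasLaw (fun p : ℝ × ℝ => p.1 * a.re) _ (γ.prod γ) :=
    gaussianReal_mul_const measurePreserving_fst.hasLaw a.re
  have hsnd : HasLaw (fun p : ℝ × ℝ => p.2 * -a.im) _ (γ.prod γ) :=
    gaussianReal_mul_const measurePreserving_snd.hasLaw (-a.im)
  have hindep : IndepFun (fun p : ℝ × ℝ => p.1 * a.re) (fun p => p.2 * -a.im) (γ.prod γ) :=
    indepFun_prod (X := (· * a.re)) (Y := (· * -a.im)) (by fun_prop) (by fun_prop)
  convert! gaussianReal_add_gaussianReal_of_indepFun hindep hfst.map_eq hsnd.map_eq using 2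
  · ext p
    simp [sub_eq_add_neg]
  · simp
  · ext
    push_cast
    rw [← Complex.normSq_eq_norm_sq, Complex.normSq_apply]
    simp
    ring

variable {Ω : Type*} [MeasurableSpace Ω] {P : Measure Ω} {Z : Ω → ℂ}

lemma hasLaw_re_mul (hZ : HasLaw Z stdComplexGaussian P) (a : ℂ) :
    HasLaw (fun ω => (Z ω * a).re) (gaussianReal 0 (‖a‖₊ ^ 2 / 2)) P :=
  HasLaw.comp (Y := fun z : ℂ => (z * a).re)
    ⟨by fun_prop, map_re_mul_stdComplexGaussian a⟩ hZ

lemma hasLaw_re (hZ : HasLaw Z stdComplexGaussian P) :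
    HasLaw (fun ω => (Z ω).re) (gaussianReal 0 (1 / 2)) P := by
  simpa using hasLaw_re_mul hZ 1

lemma hasLaw_im (hZ : HasLaw Z stdComplexGaussian P) :
    HasLaw (fun ω => (Z ω).im) (gaussianReal 0 (1 / 2)) P := by
  simpa using hasLaw_re_mul hZ (-Complex.I)

lemma integrable_norm_sq (hZ : HasLaw Z stdComplexGaussian P) :
    Integrable (fun ω => ‖Z ω‖ ^ 2) P := by
  simp only [Complex.sq_norm, Complex.normSq_apply, ← sq]
  exact (integrable_sq_of_hasLaw_gaussianReal (hasLaw_re hZ)).add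
      (integrable_sq_of_hasLaw_gaussianReal (hasLaw_im hZ))

lemma integral_norm_sq (hZ : HasLaw Z stdComplexGaussian P) : ∫ ω, ‖Z ω‖ ^ 2 ∂P = 1 := by
  simp only [Complex.sq_norm, Complex.normSq_apply, ← sq]
  rw [integral_add (integrable_sq_of_hasLaw_gaussianReal (hasLaw_re hZ))
      (integrable_sq_of_hasLaw_gaussianReal (hasLaw_im hZ)),
    integral_sq_of_hasLaw_gaussianReal (hasLaw_re hZ),
    integral_sq_of_hasLaw_gaussianReal (hasLaw_im hZ)]
  norm_num

end ComplexGaussian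

/-! ### Level fields with Gaussian coefficients -/

lemma hasSum_norm_exp_mul_landauMode_sq (n : ℕ) (z : ℂ) :
    HasSum (fun k => ‖(Real.exp (-‖z‖ ^ 2 / 2) : ℂ) * landauMode n k z‖ ^ 2) 1 := by
  have hexp : Real.exp (-‖z‖ ^ 2) * Real.exp (‖z‖ ^ 2) = 1 := by
    rw [← Real.exp_add, neg_add_cancel, Real.exp_zero]
  simp only [norm_exp_mul_sq]
  exact hexp ▸ (hasSum_norm_landauMode_sq n z).mul_left (Real.exp (-‖z‖ ^ 2))

lemma AdmissibleCoeff.hasSum_weightedField {c : ℕ → ℂ} (hc : AdmissibleCoeff c) (n : ℕ) (z : ℂ) :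
    HasSum (fun k => c k * ((Real.exp (-‖z‖ ^ 2 / 2) : ℂ) * landauMode n k z))
      (weightedField c n z) := by
  simpa only [mul_left_comm, weightedField] using
    (hc.hasSum_landauField n z).mul_left (Real.exp (-‖z‖ ^ 2 / 2) : ℂ)

lemma summable_one_div_add_one_sq : Summable fun k : ℕ => 1 / ((k : ℝ) + 1) ^ 2 := by
  exact_mod_cast (summable_nat_add_iff 1).2 (Real.summable_one_div_nat_pow.2 one_lt_two)

section IID

variable {Ω : Type*} [MeasurableSpace Ω] {P : Measure Ω} {ζ : ℕ → Ω → ℂ}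
  (hlaw : ∀ k, HasLaw (ζ k) stdComplexGaussian P)

include hlaw

lemma ae_admissibleCoeff : ∀ᵐ ω ∂P, AdmissibleCoeff fun k => ζ k ω := by
  have hint (k : ℕ) : Integrable (fun ω => ‖ζ k ω‖ ^ 2 / ((k : ℝ) + 1) ^ 2) P :=
    (integrable_norm_sq (hlaw k)).div_const _
  have hnorm (k : ℕ) (ω : Ω) :
      ‖‖ζ k ω‖ ^ 2 / ((k : ℝ) + 1) ^ 2‖ = ‖ζ k ω‖ ^ 2 / ((k : ℝ) + 1) ^ 2 :=
    Real.norm_of_nonneg (by positivity)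
  have heLpNorm (k : ℕ) : eLpNorm (fun ω => ‖ζ k ω‖ ^ 2 / ((k : ℝ) + 1) ^ 2) 1 P =
      ENNReal.ofReal (1 / ((k : ℝ) + 1) ^ 2) := by
    rw [eLpNorm_one_eq_lintegral_enorm, ← ofReal_integral_norm_eq_lintegral_enorm (hint k)]
    simp only [hnorm]
    rw [integral_div, integral_norm_sq (hlaw k)]
  have hae := summable_norm_of_tsum_eLpNorm_ne_top le_rfl (fun k => (hint k).aestronglyMeasurable)
    (by simpa only [heLpNorm] using summable_one_div_add_one_sq.tsum_ofReal_ne_top)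
  simpa only [hnorm, AdmissibleCoeff] using hae

variable (hindep : iIndepFun ζ P)

include hindep

lemma ae_tendsto_average_norm_sq :
    ∀ᵐ ω ∂P, Tendsto (fun N : ℕ => (∑ n ∈ Finset.range N, ‖ζ n ω‖ ^ 2) / N) atTop (𝓝 1) := by
  have hm : Measurable fun z : ℂ => ‖z‖ ^ 2 := by fun_prop
  have hident (i : ℕ) : IdentDistrib (ζ i) (ζ 0) P P :=
    ⟨(hlaw i).aemeasurable, (hlaw 0).aemeasurable, (hlaw i).map_eq.trans (hlaw 0).map_eq.symm⟩
  simpa only [integral_norm_sq (hlaw 0)] using strong_law_ae_real (fun n ω => ‖ζ n ω‖ ^ 2)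
    (integrable_norm_sq (hlaw 0)) (fun i j hij => (hindep.indepFun hij).comp hm hm)
    fun i => (hident i).comp hm

lemma hasSubgaussianMGF_re_of_hasSum {a : ℕ → ℂ} {v : ℝ≥0} (ha : HasSum (fun k => ‖a k‖₊ ^ 2) v)
    {Y : Ω → ℂ} (hY : ∀ᵐ ω ∂P, HasSum (fun k => ζ k ω * a k) (Y ω)) :
    HasSubgaussianMGF (fun ω => (Y ω).re) (v / 2) P := by
  have hterm (k : ℕ) := hasSubgaussianMGF_of_hasLaw_gaussianReal (hasLaw_re_mul (hlaw k) (a k))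
  have hindep_re : iIndepFun (fun k ω => (ζ k ω * a k).re) P :=
    hindep.comp (fun k z => (z * a k).re) fun k => by fun_prop
  refine hasSubgaussianMGF_of_tendsto_ae (fun K => hasSubgaussianMGF_mono
    (HasSubgaussianMGF.sum_of_iIndepFun hindep_re (s := Finset.range K) fun k _ => hterm k) ?_) ?_
  · rw [← Finset.sum_div]
    gcongr
    exact ha.summable.sum_le_tsum _ (fun _ _ => zero_le) |>.trans_eq ha.tsum_eq
  · filter_upwards [hY] with ω hω
    exact (Complex.hasSum_re hω).tendsto_sum_nat

lemma measureReal_lt_norm_weightedField_sq_le (n : ℕ) (z : ℂ) {t : ℝ} (ht : 0 ≤ t) :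
    P.real {ω | 2 * t ^ 2 < ‖weightedField (fun k => ζ k ω) n z‖ ^ 2} ≤ 4 * Real.exp (-t ^ 2) := by
  have := hindep.isProbabilityMeasure
  suffices h : ∀ u : ℂ, ‖u‖ = 1 → HasSubgaussianMGF
      (fun ω => (weightedField (fun k => ζ k ω) n z * u).re) (1 / 2) P by
    simpa using measureReal_two_mul_sq_lt_norm_sq_le h ht
  intro u hu
  refine hasSubgaussianMGF_re_of_hasSum hlaw hindep
    (a := fun k => (Real.exp (-‖z‖ ^ 2 / 2) : ℂ) * landauMode n k z * u) ?_ ?_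
  · rw [← NNReal.hasSum_coe]
    simpa [hu] using hasSum_norm_exp_mul_landauMode_sq n z
  · filter_upwards [ae_admissibleCoeff hlaw] with ω hω
    simpa only [mul_assoc] using (hω.hasSum_weightedField n z).mul_right u

-- At height `16 log (n + 1)` the tail is of order `(n + 1)⁻⁸`, which beats the size of the net.
lemma ae_eventually_forall_net_norm_weightedField_sq_le {net : ℕ → Finset ℂ} {D : ℕ}
    (hcard : ∀ n, (net n).card ≤ D * (n + 1) ^ 6) :
    ∀ᵐ ω ∂P, ∀ᶠ n : ℕ in atTop, ∀ p ∈ net n,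
      ‖weightedField (fun k => ζ k ω) n p‖ ^ 2 ≤ 16 * Real.log (n + 1) := by
  have := hindep.isProbabilityMeasure
  set bad : ℕ → ℂ → Set Ω := fun n p =>
    {ω | 16 * Real.log (n + 1) < ‖weightedField (fun k => ζ k ω) n p‖ ^ 2}
  have hpoint (n : ℕ) (p : ℂ) : P.real (bad n p) ≤ 4 * (1 / ((n : ℝ) + 1) ^ 8) := by
    have hlog : 0 ≤ 8 * Real.log ((n : ℝ) + 1) :=
      mul_nonneg (by norm_num) (Real.log_nonneg (by simp))
    have htail := measureReal_lt_norm_weightedField_sq_le hlaw hindep n p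
      (Real.sqrt_nonneg (8 * Real.log ((n : ℝ) + 1)))
    have hexp : Real.exp (-(8 * Real.log ((n : ℝ) + 1))) = 1 / ((n : ℝ) + 1) ^ 8 := by
      rw [Real.exp_neg, one_div, ← Nat.cast_ofNat, Real.exp_nat_mul, Real.exp_log (by positivity)]
    rw [Real.sq_sqrt hlog, hexp, ← mul_assoc] at htail
    convert! htail
    norm_num
  have hnet (n : ℕ) : P.real (⋃ p ∈ net n, bad n p) ≤ 4 * D * (1 / ((n : ℝ) + 1) ^ 2) :=
    calc _ ≤ ∑ p ∈ net n, P.real (bad n p) := measureReal_biUnion_finset_le _ _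
      _ ≤ (net n).card * (4 * (1 / ((n : ℝ) + 1) ^ 8)) := by
          rw [← nsmul_eq_mul]
          exact Finset.sum_le_card_nsmul _ _ _ fun p _ => hpoint n p
      _ ≤ (D * ((n : ℝ) + 1) ^ 6) * (4 * (1 / ((n : ℝ) + 1) ^ 8)) := by
          gcongr
          exact_mod_cast hcard n
      _ = _ := by field_simp
  have hfin : ∑' n, P (⋃ p ∈ net n, bad n p) ≠ ∞ := by
    have hsum : Summable fun n => P.real (⋃ p ∈ net n, bad n p) :=
      .of_nonneg_of_le (fun _ => measureReal_nonneg) hnet (summable_one_div_add_one_sq.mul_left _)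
    simpa only [ofReal_measureReal (measure_ne_top _ _)] using hsum.tsum_ofReal_ne_top
  filter_upwards [ae_eventually_notMem hfin] with ω hω
  filter_upwards [hω] with n hn p hp
  exact not_lt.1 fun h => hn (Set.mem_biUnion hp h)

lemma ae_eventually_norm_weightedField_sq_le (R : ℕ) :
    ∀ᵐ ω ∂P, ∀ᶠ n : ℕ in atTop, ∀ z ∈ closedBall (0 : ℂ) R,
      ‖weightedField (fun k => ζ k ω) n z‖ ^ 2 ≤ 17 * Real.log (n + 1) := by
  choose net hcard hnet using fun n : ℕ =>
    exists_finset_net_closedBall R (pow_pos n.succ_pos 3)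
  have hcard' (n : ℕ) : (net n).card ≤ (2 * R + 1) ^ 2 * (n + 1) ^ 6 := by
    simpa only [mul_pow, ← pow_mul] using hcard n
  filter_upwards [ae_admissibleCoeff hlaw,
    ae_eventually_forall_net_norm_weightedField_sq_le hlaw hindep hcard'] with ω hω hlog
  convert! hω.eventually_norm_weightedField_sq_le_of_net hnet hlog using 6
  norm_num

end IID

end LandauLevels

end

theorem theorem5p2_general {Ω : Type*} [MeasurableSpace Ω] {P : Measure Ω} {ζ : ℕ → Ω → ℂ}
    (hlaw : ∀ k, HasLaw (ζ k) LandauLevels.stdComplexGaussian P) (hindep : iIndepFun ζ P) :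
    (∀ᵐ ω ∂P, ∀ z : ℂ, Summable (LandauLevels.gefTerm (fun k => ζ k ω) z)) ∧
    ∀ᵐ ω ∂P, ∀ K : Set ℂ, Bornology.IsBounded K → ∀ α ≤ 1,
      LandauLevels.TendstoHolder α K
        (fun N => LandauLevels.averagedField (fun k => ζ k ω) N) (fun _ => 1) := by
  refine ⟨(LandauLevels.ae_admissibleCoeff hlaw).mono fun ω hω => hω.summable_gefTerm, ?_⟩
  filter_upwards [LandauLevels.ae_admissibleCoeff hlaw,
    LandauLevels.ae_tendsto_average_norm_sq hlaw hindep,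
    ae_all_iff.2 (LandauLevels.ae_eventually_norm_weightedField_sq_le hlaw hindep)]
    with ω hc haverage hlog K hK α hα
  obtain ⟨r, hr⟩ := hK.subset_closedBall 0
  obtain ⟨R, hR⟩ := exists_nat_ge r
  exact (hc.tendstoHolder_averagedField hα R.cast_nonneg (by norm_num) (hlog R) haverage).mono
    (hr.trans (Metric.closedBall_subset_closedBall hR))

theorem theorem5p2 {Ω : Type*} [MeasurableSpace Ω] (P : Measure Ω) [IsProbabilityMeasure P]
    (ζ : ℕ → Ω → ℂ) (hlaw : ∀ k, HasLaw (ζ k) LandauLevels.stdComplexGaussian P)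
    (hindep : iIndepFun ζ P) :
    (∀ᵐ ω ∂P, ∀ z : ℂ, Summable (LandauLevels.gefTerm (fun k => ζ k ω) z)) ∧
    ∀ K : Set ℂ, IsCompact K → ∀ α : ℝ, 0 < α → α < 1 →
      ∀ᵐ ω ∂P, LandauLevels.TendstoHolder α K
        (fun N => LandauLevels.averagedField (fun k => ζ k ω) N) (fun _ => 1) := by
  obtain ⟨hsummable, htendsto⟩ := theorem5p2_general hlaw hindep
  exact ⟨hsummable, fun K hK α _ hα => htendsto.mono fun ω h => h K hK.isBounded α hα.le⟩
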